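/- Let $H$ be a complex Hilbert space (not necessarily separable or finite-dimensional), let $H\hat\otimes_2 H$ be its Hilbertian tensor square (the completion of $H\otimes_{\mathbb C}H$ for the inner product with $\langle x\otimes y,x'\otimes y'\rangle=\langle x,x'\rangle\langle y,y'\rangle$), and let $\mu\colon H\hat\otimes_2 H\to H$ be a bounded linear map. Let $\alpha\colon (H\hat\otimes_2 H)\hat\otimes_2 H\to H\hat\otimes_2(H\hat\otimes_2 H)$ be the unitary associator, $(x\otimes y)\otimes z\mapsto x\otimes(y\otimes z)$, let $\sigma\colon H\hat\otimes_2H\to H\hat\otimes_2H$ be the unitary flip, $x\otimes y\mapsto y\otimes x$, and let $^\dagger$ denote the Hilbert adjoint. Assume that $(H,\mu)$ is a (commutative) Hilbertian algebra, that is, $\mu\circ(\mu\hat\otimes_2 \mathrm{id})=\mu\circ(\mathrm{id}\hat\otimes_2\mu)\circ\alpha$ and $\mu\circ\sigma=\mu$. For $u\in H$ let $M_u\colon H\to H$ be the bounded operator $M_u(w)=\mu(u\otimes w)$. Then the following are equivalent: 1. $(H,\mu)$ is a Hilbertian $H^*$-algebra: for every $u\in H$ there is $v\in H$ with $M_u^\dagger=M_v$.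 2. $(H,\mu)$ is a Hilbertian Frobenius semigroup: $$(\mu\hat\otimes_2\mathrm{id})\circ\alpha^{-1}\circ(\mathrm{id}\hat\otimes_2\mu^\dagger)=\mu^\dagger\circ\mu=(\mathrm{id}\hat\otimes_2\mu)\circ\alpha\circ(\mu^\dagger\hat\otimes_2\mathrm{id}).$$ -/

import Mathlib

open scoped TensorProduct

noncomputable section

universe u v w

/-! ### The Hilbertian tensor product -/

/-- The Hilbertian tensor product of `H` and `K`: the completion of the algebraic tensor product
with respect to the inner product `⟪x ⊗ y, x' ⊗ y'⟫ = ⟪x, x'⟫ * ⟪y, y'⟫`. -/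
abbrev HilbertTensor (H : Type u) (K : Type v)
    [NormedAddCommGroup H] [InnerProductSpace ℂ H]
    [NormedAddCommGroup K] [InnerProductSpace ℂ K] : Type (max u v) :=
  UniformSpace.Completion (H ⊗[ℂ] K)

namespace HilbertTensor

section Basic

variable {H : Type u} {K : Type v} {L : Type w}
  [NormedAddCommGroup H] [InnerProductSpace ℂ H]
  [NormedAddCommGroup K] [InnerProductSpace ℂ K]
  [NormedAddCommGroup L] [InnerProductSpace ℂ L]

/-- The elementary tensor `x ⊗ y`. -/
def tmul (x : H) (y : K) : HilbertTensor H K :=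
  ((x ⊗ₜ[ℂ] y : H ⊗[ℂ] K) : UniformSpace.Completion (H ⊗[ℂ] K))

/-- The bounded linear map `y ↦ x ⊗ y`. -/
def tmulLeft (K : Type v) [NormedAddCommGroup K] [InnerProductSpace ℂ K] (x : H) :
    K →L[ℂ] HilbertTensor H K :=
  UniformSpace.Completion.toComplL ∘L TensorProduct.mkL ℂ H K x

@[simp] theorem tmulLeft_apply (x : H) (y : K) : tmulLeft K x y = tmul x y := rfl

theorem inner_tmul (x x' : H) (y y' : K) :
    inner ℂ (tmul x y) (tmul x' y') = inner ℂ x x' * inner ℂ y y' := by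
  simp [tmul]

/-- The symmetry constraint `x ⊗ y ↦ y ⊗ x`. -/
def comm (H : Type u) (K : Type v)
    [NormedAddCommGroup H] [InnerProductSpace ℂ H]
    [NormedAddCommGroup K] [InnerProductSpace ℂ K] :
    HilbertTensor H K →L[ℂ] HilbertTensor K H :=
  ((TensorProduct.commIsometry ℂ H K).toContinuousLinearEquiv :
    H ⊗[ℂ] K →L[ℂ] K ⊗[ℂ] H).completion

@[simp] theorem comm_tmul (x : H) (y : K) : comm H K (tmul x y) = tmul y x := by
  simp [comm, tmul]

/-- The canonical isometry of the algebraic triple tensor product into the Hilbertian one, with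
parentheses on the left. -/
def embLeft (H : Type u) (K : Type v) (L : Type w)
    [NormedAddCommGroup H] [InnerProductSpace ℂ H]
    [NormedAddCommGroup K] [InnerProductSpace ℂ K]
    [NormedAddCommGroup L] [InnerProductSpace ℂ L] :
    (H ⊗[ℂ] K) ⊗[ℂ] L →ₗᵢ[ℂ] HilbertTensor (HilbertTensor H K) L :=
  UniformSpace.Completion.toComplₗᵢ.comp
    (TensorProduct.mapIsometry UniformSpace.Completion.toComplₗᵢ LinearIsometry.id)

/-- The canonical isometry of the algebraic triple tensor product into the Hilbertian one, with
parentheses on the right. -/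
def embRight (H : Type u) (K : Type v) (L : Type w)
    [NormedAddCommGroup H] [InnerProductSpace ℂ H]
    [NormedAddCommGroup K] [InnerProductSpace ℂ K]
    [NormedAddCommGroup L] [InnerProductSpace ℂ L] :
    H ⊗[ℂ] (K ⊗[ℂ] L) →ₗᵢ[ℂ] HilbertTensor H (HilbertTensor K L) :=
  UniformSpace.Completion.toComplₗᵢ.comp
    (TensorProduct.mapIsometry LinearIsometry.id UniformSpace.Completion.toComplₗᵢ)

@[simp] theorem embLeft_tmul (x : H) (y : K) (z : L) :
    embLeft H K L ((x ⊗ₜ y) ⊗ₜ z) = tmul (tmul x y) z := rfl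

@[simp] theorem embRight_tmul (x : H) (y : K) (z : L) :
    embRight H K L (x ⊗ₜ (y ⊗ₜ z)) = tmul x (tmul y z) := rfl

theorem denseRange_embLeft : DenseRange (embLeft H K L) := by
  have h : DenseRange (TensorProduct.mapIsometry
      (UniformSpace.Completion.toComplₗᵢ : (H ⊗[ℂ] K) →ₗᵢ[ℂ] HilbertTensor H K)
      (LinearIsometry.id : L →ₗᵢ[ℂ] L)) := by
    intro t
    induction t with
    | zero => exact subset_closure ⟨0, map_zero _⟩
    | add a b ha hb =>
      rw [← LinearIsometry.coe_toLinearMap, ← LinearMap.coe_range,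
        ← Submodule.topologicalClosure_coe] at ha hb ⊢
      exact add_mem ha hb
    | tmul a z =>
      induction a using UniformSpace.Completion.induction_on with
      | hp =>
        exact isClosed_closure.preimage
          (TensorProduct.continuous_tmul.comp (continuous_id.prodMk continuous_const))
      | ih a => exact subset_closure ⟨a ⊗ₜ z, rfl⟩
  exact UniformSpace.Completion.denseRange_coe.comp h (UniformSpace.Completion.continuous_coe _)

theorem denseRange_embRight : DenseRange (embRight H K L) := by
  have h : DenseRange (TensorProduct.mapIsometry (LinearIsometry.id : H →ₗᵢ[ℂ] H)
      (UniformSpace.Completion.toComplₗᵢ : (K ⊗[ℂ] L) →ₗᵢ[ℂ] HilbertTensor K L)) := by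
    intro t
    induction t with
    | zero => exact subset_closure ⟨0, map_zero _⟩
    | add a b ha hb =>
      rw [← LinearIsometry.coe_toLinearMap, ← LinearMap.coe_range,
        ← Submodule.topologicalClosure_coe] at ha hb ⊢
      exact add_mem ha hb
    | tmul x b =>
      induction b using UniformSpace.Completion.induction_on with
      | hp =>
        exact isClosed_closure.preimage
          (TensorProduct.continuous_tmul.comp (continuous_const.prodMk continuous_id))
      | ih b => exact subset_closure ⟨x ⊗ₜ b, rfl⟩
  exact UniformSpace.Completion.denseRange_coe.comp h (UniformSpace.Completion.continuous_coe _)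

theorem norm_embRight_assoc (t : (H ⊗[ℂ] K) ⊗[ℂ] L) :
    ‖(embRight H K L).toLinearMap (TensorProduct.assoc ℂ H K L t)‖ =
      ‖(embLeft H K L).toLinearMap t‖ :=
  ((embRight H K L).norm_map _).trans
    ((TensorProduct.norm_assoc t).trans ((embLeft H K L).norm_map t).symm)

/-- The associativity constraint: the unitary map with `(x ⊗ y) ⊗ z ↦ x ⊗ (y ⊗ z)`. -/
def assoc (H : Type u) (K : Type v) (L : Type w)
    [NormedAddCommGroup H] [InnerProductSpace ℂ H]
    [NormedAddCommGroup K] [InnerProductSpace ℂ K]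
    [NormedAddCommGroup L] [InnerProductSpace ℂ L] :
    HilbertTensor (HilbertTensor H K) L ≃ₗᵢ[ℂ] HilbertTensor H (HilbertTensor K L) :=
  (TensorProduct.assoc ℂ H K L).extendOfIsometry
    (embLeft H K L).toLinearMap (embRight H K L).toLinearMap
    denseRange_embLeft denseRange_embRight norm_embRight_assoc

@[simp] theorem assoc_tmul (x : H) (y : K) (z : L) :
    assoc H K L (tmul (tmul x y) z) = tmul x (tmul y z) :=
  LinearEquiv.extendOfIsometry_eq _ (embLeft H K L).toLinearMap (embRight H K L).toLinearMap
    denseRange_embLeft denseRange_embRight norm_embRight_assoc ((x ⊗ₜ y) ⊗ₜ z)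

@[simp] theorem assoc_symm_tmul (x : H) (y : K) (z : L) :
    (assoc H K L).symm (tmul x (tmul y z)) = tmul (tmul x y) z := by
  rw [← assoc_tmul, LinearIsometryEquiv.symm_apply_apply]

end Basic

section Map

variable {H H' K K' : Type u}
  [NormedAddCommGroup H] [InnerProductSpace ℂ H]
  [NormedAddCommGroup H'] [InnerProductSpace ℂ H']
  [NormedAddCommGroup K] [InnerProductSpace ℂ K]
  [NormedAddCommGroup K'] [InnerProductSpace ℂ K']

/-- The Hilbertian tensor product of two bounded linear maps. -/
def map (f : H →L[ℂ] H') (g : K →L[ℂ] K') : HilbertTensor H K →L[ℂ] HilbertTensor H' K' :=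
  (TensorProduct.mapL f g).completion

@[simp] theorem map_tmul (f : H →L[ℂ] H') (g : K →L[ℂ] K') (x : H) (y : K) :
    map f g (tmul x y) = tmul (f x) (g y) := by
  simp [map, tmul]

end Map

end HilbertTensor

/-! ### Hilbertian algebras -/

section Algebras

variable {H : Type u} [NormedAddCommGroup H] [InnerProductSpace ℂ H]

/-- `(H, μ)` is a Hilbertian algebra: a commutative semigroup object in the symmetric monoidal
category of complex Hilbert spaces with the Hilbertian tensor product. -/
structure IsHilbertianAlgebra (μ : HilbertTensor H H →L[ℂ] H) : Prop where
  assoc : μ ∘L HilbertTensor.map μ (ContinuousLinearMap.id ℂ H) =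
    μ ∘L HilbertTensor.map (ContinuousLinearMap.id ℂ H) μ ∘L
      ((HilbertTensor.assoc H H H).toContinuousLinearEquiv :
        HilbertTensor (HilbertTensor H H) H →L[ℂ] HilbertTensor H (HilbertTensor H H))
  comm : μ ∘L HilbertTensor.comm H H = μ

/-- The multiplication operator `M_u : v ↦ u v = μ (u ⊗ v)`. -/
def mulOperator (μ : HilbertTensor H H →L[ℂ] H) (u : H) : H →L[ℂ] H :=
  μ ∘L HilbertTensor.tmulLeft H u

@[simp] theorem mulOperator_apply (μ : HilbertTensor H H →L[ℂ] H) (u v : H) :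
    mulOperator μ u v = μ (HilbertTensor.tmul u v) := rfl

variable [CompleteSpace H]

/-- `v` is an `H*`-adjoint of `u`: the Hilbert adjoint of `M_u` is `M_v`. -/
def IsHStarAdjoint (μ : HilbertTensor H H →L[ℂ] H) (u v : H) : Prop :=
  ContinuousLinearMap.adjoint (mulOperator μ u) = mulOperator μ v

/-- `(H, μ)` is a Hilbertian `H*`-algebra: a Hilbertian algebra each element of which has an
`H*`-adjoint. -/
structure IsHilbertianHStarAlgebra (μ : HilbertTensor H H →L[ℂ] H) : Prop
    extends IsHilbertianAlgebra μ where
  exists_adjoint : ∀ u : H, ∃ v : H, IsHStarAdjoint μ u v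

/-- The Frobenius condition on `μ`, with `δ` the Hilbert adjoint of `μ`:
`(μ ⊗ id) ∘ α⁻¹ ∘ (id ⊗ δ) = δ ∘ μ` and `(id ⊗ μ) ∘ α ∘ (δ ⊗ id) = δ ∘ μ`. -/
structure IsDaggerFrobenius (μ : HilbertTensor H H →L[ℂ] H) : Prop where
  top_cell :
    HilbertTensor.map μ (ContinuousLinearMap.id ℂ H) ∘L
      ((HilbertTensor.assoc H H H).symm.toContinuousLinearEquiv :
        HilbertTensor H (HilbertTensor H H) →L[ℂ] HilbertTensor (HilbertTensor H H) H) ∘L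
      HilbertTensor.map (ContinuousLinearMap.id ℂ H) (ContinuousLinearMap.adjoint μ) =
    ContinuousLinearMap.adjoint μ ∘L μ
  bottom_cell :
    HilbertTensor.map (ContinuousLinearMap.id ℂ H) μ ∘L
      ((HilbertTensor.assoc H H H).toContinuousLinearEquiv :
        HilbertTensor (HilbertTensor H H) H →L[ℂ] HilbertTensor H (HilbertTensor H H)) ∘L
      HilbertTensor.map (ContinuousLinearMap.adjoint μ) (ContinuousLinearMap.id ℂ H) =
    ContinuousLinearMap.adjoint μ ∘L μ

/-- `(H, μ)` is a Hilbertian Frobenius semigroup: a Hilbertian algebra satisfying the Frobenius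
condition. -/
structure IsHilbertianFrobeniusSemigroup (μ : HilbertTensor H H →L[ℂ] H) : Prop
    extends IsHilbertianAlgebra μ, IsDaggerFrobenius μ

end Algebras

end

/-!
Call a bounded operator `T` on `H` a multiplier if `T (x y) = (T x) y`. The two Frobenius
equations say `(M_u ⊗ id) μ† = μ† M_u` and, by commutativity, `(id ⊗ M_u) μ† = μ† M_u`; taking
adjoints, each becomes the statement that every `M_u†` is a multiplier. In an `H*`-algebra this
holds since `M_u† = M_v` and, by associativity, `M_v` is a multiplier.

Conversely, if all `M_u†` are multipliers, then
`⟪M_y† z, M_a† b⟫ = ⟪a z, b y⟫ = ⟪M_b† a, M_z† y⟫`. So the conjugate-linear correspondence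
`M_z† y ↦ M_y† z` is isometric, and `∑ cᵢ M_{zᵢ}† yᵢ ↦ ∑ cᵢ ⟪M_{yᵢ}† zᵢ, u⟫` is a well-defined
functional of norm at most `‖u‖`. Its Riesz representative `v` satisfies `M_u† = M_v`.
-/

section InnerProductSpace

open scoped ComplexConjugate InnerProductSpace

variable {𝕜 E F V ι : Type*} [RCLike 𝕜] [NormedAddCommGroup E] [InnerProductSpace 𝕜 E]
  [NormedAddCommGroup F] [InnerProductSpace 𝕜 F]

theorem exists_forall_inner_apply_eq_of_norm_le [CompleteSpace E] [AddCommGroup V] [Module 𝕜 V]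
    (e : V →ₗ[𝕜] E) (φ : V →ₗ[𝕜] 𝕜) {C : ℝ} (hφ : ∀ c, ‖φ c‖ ≤ C * ‖e c‖) :
    ∃ v : E, ∀ c, ⟪v, e c⟫_𝕜 = φ c := by
  obtain ⟨g, hg, -⟩ := exists_extension_norm_eq (LinearMap.range e) (φ.extendOfNorm e.rangeRestrict)
  refine ⟨(InnerProductSpace.toDual 𝕜 E).symm g, fun c => ?_⟩
  calc ⟪(InnerProductSpace.toDual 𝕜 E).symm g, e c⟫_𝕜 = g (e c) :=
        InnerProductSpace.toDual_symm_apply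
    _ = φ.extendOfNorm e.rangeRestrict (e.rangeRestrict c) := hg (e.rangeRestrict c)
    _ = φ c := LinearMap.extendOfNorm_eq e.surjective_rangeRestrict.denseRange ⟨C, hφ⟩ c

theorem norm_sum_conj_smul_eq_norm_sum_smul {e : ι → E} {f : ι → F}
    (h : ∀ i j, ⟪e i, e j⟫_𝕜 = ⟪f j, f i⟫_𝕜) (s : Finset ι) (c : ι → 𝕜) :
    ‖∑ i ∈ s, conj (c i) • f i‖ = ‖∑ i ∈ s, c i • e i‖ := by
  have inner_eq : ⟪∑ i ∈ s, conj (c i) • f i, ∑ i ∈ s, conj (c i) • f i⟫_𝕜 =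
      ⟪∑ i ∈ s, c i • e i, ∑ i ∈ s, c i • e i⟫_𝕜 := by
    simp only [sum_inner, inner_sum, inner_smul_left, inner_smul_right, RCLike.conj_conj, h,
      Finset.mul_sum]
    rw [Finset.sum_comm]
    exact Finset.sum_congr rfl fun i _ => Finset.sum_congr rfl fun j _ => mul_left_comm _ _ _
  rw [norm_eq_sqrt_re_inner (𝕜 := 𝕜), norm_eq_sqrt_re_inner (𝕜 := 𝕜), inner_eq]

theorem exists_forall_inner_eq_of_inner_eq_swap [CompleteSpace E] {e : ι → E} {f : ι → F}
    (h : ∀ i j, ⟪e i, e j⟫_𝕜 = ⟪f j, f i⟫_𝕜) (u : F) :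
    ∃ v : E, ∀ i, ⟪v, e i⟫_𝕜 = ⟪f i, u⟫_𝕜 := by
  have bound (c : ι →₀ 𝕜) :
      ‖Finsupp.linearCombination 𝕜 (fun i => ⟪f i, u⟫_𝕜) c‖ ≤
        ‖u‖ * ‖Finsupp.linearCombination 𝕜 e c‖ :=
    calc ‖Finsupp.linearCombination 𝕜 (fun i => ⟪f i, u⟫_𝕜) c‖
        = ‖⟪∑ i ∈ c.support, conj (c i) • f i, u⟫_𝕜‖ := by
          simp [Finsupp.linearCombination_apply, Finsupp.sum, sum_inner, inner_smul_left]
      _ ≤ ‖∑ i ∈ c.support, conj (c i) • f i‖ * ‖u‖ := norm_inner_le_norm _ _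
      _ = ‖u‖ * ‖Finsupp.linearCombination 𝕜 e c‖ := by
          rw [norm_sum_conj_smul_eq_norm_sum_smul h, mul_comm]; rfl
  obtain ⟨v, hv⟩ := exists_forall_inner_apply_eq_of_norm_le _ _ bound
  exact ⟨v, fun i => by simpa using hv (Finsupp.single i 1)⟩

end InnerProductSpace

namespace HilbertTensor

open scoped InnerProduct

theorem ext_tmul {H : Type u} {K : Type v} {E : Type w}
    [NormedAddCommGroup H] [InnerProductSpace ℂ H]
    [NormedAddCommGroup K] [InnerProductSpace ℂ K] [NormedAddCommGroup E] [NormedSpace ℂ E]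
    {f g : HilbertTensor H K →L[ℂ] E} (h : ∀ x y, f (tmul x y) = g (tmul x y)) : f = g := by
  have eq_on_algebraic : f.toLinearMap ∘ₗ UniformSpace.Completion.toComplL.toLinearMap =
      g.toLinearMap ∘ₗ UniformSpace.Completion.toComplL.toLinearMap :=
    TensorProduct.ext' h
  exact DFunLike.coe_injective <| UniformSpace.Completion.ext f.continuous g.continuous <|
    DFunLike.congr_fun eq_on_algebraic

/-- The bounded linear map `x ↦ x ⊗ y`, the counterpart of `tmulLeft`. -/
noncomputable def tmulRight (H : Type u) {K : Type v}
    [NormedAddCommGroup H] [InnerProductSpace ℂ H]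
    [NormedAddCommGroup K] [InnerProductSpace ℂ K] (y : K) : H →L[ℂ] HilbertTensor H K :=
  comm K H ∘L tmulLeft H y

@[simp] theorem tmulRight_apply {H : Type u} {K : Type v}
    [NormedAddCommGroup H] [InnerProductSpace ℂ H]
    [NormedAddCommGroup K] [InnerProductSpace ℂ K] (x : H) (y : K) :
    tmulRight H y x = tmul x y :=
  comm_tmul y x

section Map

variable {H H' K K' L L' : Type u}
  [NormedAddCommGroup H] [InnerProductSpace ℂ H]
  [NormedAddCommGroup H'] [InnerProductSpace ℂ H']
  [NormedAddCommGroup K] [InnerProductSpace ℂ K]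
  [NormedAddCommGroup K'] [InnerProductSpace ℂ K']
  [NormedAddCommGroup L] [InnerProductSpace ℂ L]
  [NormedAddCommGroup L'] [InnerProductSpace ℂ L']

theorem map_assoc_symm_tmul (f : HilbertTensor H K →L[ℂ] H') (g : L →L[ℂ] L') (x : H)
    (t : HilbertTensor K L) :
    map f g ((assoc H K L).symm (tmul x t)) = map (f ∘L tmulLeft K x) g t := by
  have eq_comp_tmulLeft : map f g ∘L
      ((assoc H K L).symm.toContinuousLinearEquiv :
        HilbertTensor H (HilbertTensor K L) →L[ℂ] HilbertTensor (HilbertTensor H K) L) ∘L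
      tmulLeft (HilbertTensor K L) x = map (f ∘L tmulLeft K x) g :=
    ext_tmul fun y z => by simp
  exact DFunLike.congr_fun eq_comp_tmulLeft t

theorem map_assoc_tmul (f : H →L[ℂ] H') (g : HilbertTensor K L →L[ℂ] L')
    (t : HilbertTensor H K) (z : L) :
    map f g (assoc H K L (tmul t z)) = map f (g ∘L tmulRight K z) t := by
  have eq_comp_tmulRight : map f g ∘L
      ((assoc H K L).toContinuousLinearEquiv :
        HilbertTensor (HilbertTensor H K) L →L[ℂ] HilbertTensor H (HilbertTensor K L)) ∘L
      tmulRight (HilbertTensor H K) z = map f (g ∘L tmulRight K z) :=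
    ext_tmul fun x y => by simp
  simpa using DFunLike.congr_fun eq_comp_tmulRight t

variable [CompleteSpace H] [CompleteSpace H'] [CompleteSpace K] [CompleteSpace K']

theorem adjoint_map (f : H →L[ℂ] H') (g : K →L[ℂ] K') : (map f g)† = map (f†) (g†) := by
  refine ext_tmul fun x' y' => (innerSL_inj (𝕜 := ℂ)).1 (ext_tmul fun x y => ?_)
  simp [ContinuousLinearMap.adjoint_inner_left, inner_tmul]

theorem map_comp_adjoint_eq_iff [CompleteSpace L] [CompleteSpace L']
    {μ : HilbertTensor H K →L[ℂ] L} {ν : HilbertTensor H' K' →L[ℂ] L'}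
    {f : H →L[ℂ] H'} {g : K →L[ℂ] K'} {T : L →L[ℂ] L'} :
    map f g ∘L μ† = ν† ∘L T ↔ μ ∘L map (f†) (g†) = T† ∘L ν := by
  rw [← ContinuousLinearMap.adjoint.injective.eq_iff]
  simp only [ContinuousLinearMap.adjoint_comp, ContinuousLinearMap.adjoint_adjoint, adjoint_map]

end Map

end HilbertTensor

section HilbertianAlgebra

open HilbertTensor
open scoped InnerProduct InnerProductSpace

variable {H : Type u} [NormedAddCommGroup H] [InnerProductSpace ℂ H]
  {μ : HilbertTensor H H →L[ℂ] H}

theorem comp_tmulLeft_eq_mulOperator (μ : HilbertTensor H H →L[ℂ] H) (u : H) :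
    μ ∘L tmulLeft H u = mulOperator μ u := rfl

theorem comp_tmulRight_eq_mulOperator (hcomm : ∀ x y, μ (tmul x y) = μ (tmul y x)) (u : H) :
    μ ∘L tmulRight H u = mulOperator μ u := by
  ext x
  simp [hcomm x]

/-- `T` is a multiplier of `(H, μ)`: it commutes with all right multiplications, so that in the
commutative case it is an endomorphism of `H` as a module over itself. -/
def IsMultiplier (μ : HilbertTensor H H →L[ℂ] H) (T : H →L[ℂ] H) : Prop :=
  ∀ x y, T (μ (tmul x y)) = μ (tmul (T x) y)

theorem isMultiplier_iff_comp_map_left {T : H →L[ℂ] H} :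
    IsMultiplier μ T ↔ μ ∘L map T (.id ℂ H) = T ∘L μ :=
  ⟨fun h => ext_tmul fun x y => by simpa using (h x y).symm,
    fun h x y => by simpa using (DFunLike.congr_fun h (tmul x y)).symm⟩

theorem isMultiplier_iff_comp_map_right (hcomm : ∀ x y, μ (tmul x y) = μ (tmul y x))
    {T : H →L[ℂ] H} : IsMultiplier μ T ↔ μ ∘L map (.id ℂ H) T = T ∘L μ :=
  ⟨fun h => ext_tmul fun x y => by simpa [hcomm x] using (h y x).symm,
    fun h x y => by simpa [hcomm y] using (DFunLike.congr_fun h (tmul y x)).symm⟩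

theorem IsHilbertianAlgebra.mul_comm (hμ : IsHilbertianAlgebra μ) (x y : H) :
    μ (tmul x y) = μ (tmul y x) := by
  simpa using DFunLike.congr_fun hμ.comm (tmul y x)

theorem IsHilbertianAlgebra.isMultiplier_mulOperator (hμ : IsHilbertianAlgebra μ) (u : H) :
    IsMultiplier μ (mulOperator μ u) := fun x y => by
  simpa using (DFunLike.congr_fun hμ.assoc (tmul (tmul u x) y)).symm

variable [CompleteSpace H]

theorem isMultiplier_adjoint_iff_map_left {T : H →L[ℂ] H} :
    IsMultiplier μ (T†) ↔ map T (.id ℂ H) ∘L μ† = μ† ∘L T := by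
  rw [map_comp_adjoint_eq_iff, ContinuousLinearMap.adjoint_id, isMultiplier_iff_comp_map_left]

theorem isMultiplier_adjoint_iff_map_right (hcomm : ∀ x y, μ (tmul x y) = μ (tmul y x))
    {T : H →L[ℂ] H} : IsMultiplier μ (T†) ↔ map (.id ℂ H) T ∘L μ† = μ† ∘L T := by
  rw [map_comp_adjoint_eq_iff, ContinuousLinearMap.adjoint_id,
    isMultiplier_iff_comp_map_right hcomm]

theorem isDaggerFrobenius_iff_isMultiplier_adjoint
    (hcomm : ∀ x y, μ (tmul x y) = μ (tmul y x)) :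
    IsDaggerFrobenius μ ↔ ∀ u, IsMultiplier μ ((mulOperator μ u)†) where
  mp h u := isMultiplier_adjoint_iff_map_left.2 <| ContinuousLinearMap.ext fun w => by
    simpa [map_assoc_symm_tmul, comp_tmulLeft_eq_mulOperator] using
      DFunLike.congr_fun h.top_cell (tmul u w)
  mpr h :=
    { top_cell := ext_tmul fun u w => by
        simpa [map_assoc_symm_tmul, comp_tmulLeft_eq_mulOperator] using
          DFunLike.congr_fun (isMultiplier_adjoint_iff_map_left.1 (h u)) w
      bottom_cell := ext_tmul fun w u => by
        simpa [map_assoc_tmul, comp_tmulRight_eq_mulOperator hcomm, hcomm w] using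
          DFunLike.congr_fun ((isMultiplier_adjoint_iff_map_right hcomm).1 (h u)) w }

theorem isHStarAdjoint_iff_inner_adjoint (hcomm : ∀ x y, μ (tmul x y) = μ (tmul y x)) {u v : H} :
    IsHStarAdjoint μ u v ↔
      ∀ z y, ⟪v, ((mulOperator μ z)†) y⟫_ℂ = ⟪((mulOperator μ y)†) z, u⟫_ℂ := by
  simp only [IsHStarAdjoint, eq_comm (a := (mulOperator μ u)†),
    ContinuousLinearMap.eq_adjoint_iff, ContinuousLinearMap.adjoint_inner_left,
    ContinuousLinearMap.adjoint_inner_right, mulOperator_apply, hcomm v, hcomm u]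

theorem inner_adjoint_mulOperator_eq (hcomm : ∀ x y, μ (tmul x y) = μ (tmul y x))
    (hmul : ∀ u, IsMultiplier μ ((mulOperator μ u)†)) (y z a b : H) :
    ⟪((mulOperator μ y)†) z, ((mulOperator μ a)†) b⟫_ℂ = ⟪μ (tmul a z), μ (tmul b y)⟫_ℂ :=
  calc ⟪((mulOperator μ y)†) z, ((mulOperator μ a)†) b⟫_ℂ
      = ⟪z, μ (tmul y (((mulOperator μ a)†) b))⟫_ℂ := ContinuousLinearMap.adjoint_inner_left _ _ _
    _ = ⟪z, ((mulOperator μ a)†) (μ (tmul b y))⟫_ℂ := by rw [hcomm y, hmul]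
    _ = ⟪μ (tmul a z), μ (tmul b y)⟫_ℂ := ContinuousLinearMap.adjoint_inner_right _ _ _

theorem exists_isHStarAdjoint_of_isMultiplier_adjoint
    (hcomm : ∀ x y, μ (tmul x y) = μ (tmul y x))
    (hmul : ∀ u, IsMultiplier μ ((mulOperator μ u)†)) (u : H) : ∃ v, IsHStarAdjoint μ u v := by
  have inner_swap (p q : H × H) :
      ⟪((mulOperator μ p.1)†) p.2, ((mulOperator μ q.1)†) q.2⟫_ℂ =
        ⟪((mulOperator μ q.2)†) q.1, ((mulOperator μ p.2)†) p.1⟫_ℂ := by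
    simp only [inner_adjoint_mulOperator_eq hcomm hmul, hcomm q.1, hcomm q.2]
  obtain ⟨v, hv⟩ := exists_forall_inner_eq_of_inner_eq_swap inner_swap u
  exact ⟨v, (isHStarAdjoint_iff_inner_adjoint hcomm).2 fun z y => hv (z, y)⟩

end HilbertianAlgebra

theorem mainTheorem8 {H : Type*} [NormedAddCommGroup H] [InnerProductSpace ℂ H] [CompleteSpace H]
    (μ : HilbertTensor H H →L[ℂ] H) (hμ : IsHilbertianAlgebra μ) :
    IsHilbertianHStarAlgebra μ ↔ IsHilbertianFrobeniusSemigroup μ := by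
  constructor
  · intro h
    refine { toIsHilbertianAlgebra := hμ, toIsDaggerFrobenius := ?_ }
    refine (isDaggerFrobenius_iff_isMultiplier_adjoint hμ.mul_comm).2 fun u => ?_
    obtain ⟨v, hv⟩ := h.exists_adjoint u
    rw [hv]
    exact hμ.isMultiplier_mulOperator v
  · intro h
    have hmul := (isDaggerFrobenius_iff_isMultiplier_adjoint hμ.mul_comm).1 h.toIsDaggerFrobenius
    exact { toIsHilbertianAlgebra := hμ
            exists_adjoint := exists_isHStarAdjoint_of_isMultiplier_adjoint hμ.mul_comm hmul }
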